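/- **Proposition 1.** For integers $n,k\ge 1$ let $K(2n+k,n)$ be the Kneser graph: its vertices are the $n$-element subsets of a $(2n+k)$-element set, two of them being adjacent iff they are disjoint. Let $P$ be the transition matrix of the simple random walk on $K(2n+k,n)$, let $\pi$ be its stationary distribution, and for an integer $t\ge 0$ let $$d(t)=\max_{x}\|P^t(x,\cdot)-\pi\|_{TV},\qquad \|\mu-\nu\|_{TV}=\max_{A}|\mu(A)-\nu(A)|.$$ Let $k=k(n)\ge 1$ be a function of $n\ge 1$. 1. If $k=o(n)$, then for every constant $c\ge 1/2$ and all sufficiently large $n$, $$d\left(\left\lfloor \tfrac12\log_{1+k/n}(2n+k)+c\,\tfrac{n}{k}\right\rfloor\right)\le e^{-c}.$$ 2. If $k=\Omega(n)$, then for every real constant $c$, every $n\ge 1$ with $(1+k/n)^{-c}\le \tfrac12$, and every integer $t\ge \tfrac12\log_{1+k/n}(2n+k)+c$, $$d(t)\le (1+k/n)^{-c}.$$ -/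

import Mathlib

open Filter Asymptotics

/-- Vertices of the Kneser graph `K(2n+k, n)`: the `n`-element subsets of a `(2n+k)`-element set. -/
abbrev KneserVertex (n k : ℕ) : Type := {A : Finset (Fin (2 * n + k)) // A.card = n}

/-- The Kneser graph `K(2n+k, n)`: two `n`-subsets are adjacent iff they are disjoint.
(For `n ≥ 1` disjoint `n`-subsets are automatically distinct; the clause `A ≠ B` only matters
for `n = 0`.) -/
def kneserGraph (n k : ℕ) : SimpleGraph (KneserVertex n k) where
  Adj A B := A ≠ B ∧ Disjoint A.1 B.1
  symm := ⟨fun _ _ h => ⟨h.1.symm, h.2.symm⟩⟩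
  loopless := ⟨fun _ h => h.1 rfl⟩

noncomputable section

open Classical in
/-- Transition matrix of the simple random walk on a finite graph: from `x` the walk moves to a
uniformly chosen neighbour of `x`. -/
def srwMatrix {V : Type*} [Fintype V] (G : SimpleGraph V) : Matrix V V ℝ :=
  Matrix.of fun x y => if G.Adj x y then 1 / (G.degree x : ℝ) else 0

/-- `π` is a stationary probability distribution of the transition matrix `P`. -/
structure IsStationaryDist {V : Type*} [Fintype V] (P : Matrix V V ℝ) (π : V → ℝ) : Prop where
  nonneg : ∀ x, 0 ≤ π x
  sum_eq_one : ∑ x, π x = 1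
  stationary : Matrix.vecMul π P = π

/-- Total variation distance `max_A |μ(A) - ν(A)|` of two distributions on a finite set
(the supremum runs over the finitely many subsets). -/
def tvDist {V : Type*} (μ ν : V → ℝ) : ℝ :=
  ⨆ A : Finset V, |∑ x ∈ A, μ x - ∑ x ∈ A, ν x|

open Classical in
/-- Worst-case total variation distance to `π` at the integer time `t`:
`max_x ‖P^t(x, ·) - π‖_TV`. -/
def worstTV {V : Type*} [Fintype V] (P : Matrix V V ℝ) (π : V → ℝ) (t : ℕ) : ℝ :=
  ⨆ x : V, tvDist ((P ^ t) x) π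

/-- Extension to real times by `d(t) := d(⌊t⌋)`. -/
def worstTVReal {V : Type*} [Fintype V] (P : Matrix V V ℝ) (π : V → ℝ) (t : ℝ) : ℝ :=
  worstTV P π ⌊t⌋₊

end

/-!
The walk on `K(2n+k, n)` has a symmetric, vertex-transitive transition matrix `P`, so its stationary
distribution is uniform, all diagonal entries of `P ^ (2t)` agree, and Cauchy–Schwarz gives
`4 d(t)² ≤ tr P ^ (2t) - 1` (`worstTV_le_of_trace_le`). Everything therefore rests on an upper bound
for the trace of an even power of `P`.

For a set `S` let `f_S` be the indicator of `{x | S ⊆ x}`. Counting the neighbours of `x` that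
contain `S`, and applying inclusion–exclusion to the event `S ∩ x = ∅`, gives
`P f_S = C(n+k-i, k) / C(n+k, k) * ∑_{T ⊆ S} (-1)^|T| f_T` with `i = |S|`. Hence `P` is triangular
for the filtration by the spans of `{f_S : |S| < m}`, and acts on its `i`-th quotient as the scalar
`λ_i = (-1)^i C(n+k-i, k) / C(n+k, k)`. This quotient has dimension at most `C(2n+k, i)`, and the
`λ_i` are distinct, so `λ_i` is an eigenvalue of multiplicity at most `C(2n+k, i)`, and there are no
others (`trace_pow_le_of_triangular`); the exact multiplicities are not needed. The case `i = 0`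
also shows that the uniform distribution is the only stationary one.

Since `|λ_i| ≤ (n/(n+k))^i`, the binomial theorem yields
`tr P ^ (2t) ≤ (1 + (n/(n+k))^(2t))^(2n+k) ≤ exp ((2n+k) (n/(n+k))^(2t))`, and at time
`t ≥ ½ log_{1+k/n} (2n+k) + s` the exponent is at most `(1+k/n)^(-2s)`. Both parts of the theorem
are now estimates of `e^a - 1` for small `a`. In the first part rounding the time down costs a
factor `(1+k/n)²`, which is close to `1` and is absorbed by the factor `4` in the bound for `d(t)²`.
-/

/-! ### Traces of matrices that are triangular for a filtration -/

theorem Matrix.IsHermitian.trace_pow_eq_sum_eigenvalues {V : Type*} [Fintype V] [DecidableEq V]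
    {A : Matrix V V ℝ} (hA : A.IsHermitian) (m : ℕ) :
    (A ^ m).trace = ∑ j, hA.eigenvalues j ^ m := by
  conv_lhs => rw [hA.spectral_theorem, ← map_pow, Unitary.conjStarAlgAut_apply,
    Matrix.trace_mul_cycle, Unitary.coe_star_mul_self, one_mul, Matrix.diagonal_pow,
    Matrix.trace_diagonal]
  simp

section Filtration

variable {V : Type*} [Fintype V] {A : Matrix V V ℝ} {U : ℕ → Submodule ℝ (V → ℝ)} {l : ℕ → ℝ}
  {n : ℕ}

/-- If `A` acts on each quotient `U (i + 1) / U i` of a filtration starting at `⊥` as the scalar `l i`,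
then every eigenvalue of `A` is one of the `l i`: look at the first step of the filtration that
contains the eigenvector. -/
theorem exists_eq_of_triangular (hU0 : U 0 = ⊥)
    (hA : ∀ i, ∀ v ∈ U (i + 1), A.mulVec v - l i • v ∈ U i)
    {v : V → ℝ} {μ : ℝ} (hv : A.mulVec v = μ • v) (hv0 : v ≠ 0) :
    ∀ m, v ∈ U m → ∃ i < m, μ = l i := by
  intro m
  induction m with
  | zero => intro h; rw [hU0, Submodule.mem_bot] at h; exact absurd h hv0
  | succ m ih =>
    intro h
    by_cases hm : μ = l m
    · exact ⟨m, m.lt_succ_self, hm⟩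
    · have h1 := hA m v h
      rw [hv, ← sub_smul, Submodule.smul_mem_iff _ (sub_ne_zero.2 hm)] at h1
      obtain ⟨i, hi, e⟩ := ih h1
      exact ⟨i, hi.trans m.lt_succ_self, e⟩

/-- When the scalars `l i` are distinct, an eigenvector for `l i` descends through the filtration until
it reaches `U (i + 1)`. -/
theorem mem_of_triangular (hA : ∀ i, ∀ v ∈ U (i + 1), A.mulVec v - l i • v ∈ U i)
    (hl : Set.InjOn l (Set.Iic n)) {v : V → ℝ} {i : ℕ} (hi : i ≤ n)
    (hv : A.mulVec v = l i • v) (hvn : v ∈ U (n + 1)) : v ∈ U (i + 1) := by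
  refine Nat.decreasingInduction' (P := fun m => v ∈ U m) (m := i + 1) (n := n + 1) ?_ (by omega)
    hvn
  intro j hj hij hvj
  have h1 := hA j v hvj
  have hne : l i ≠ l j := fun h => by
    have := hl (Set.mem_Iic.2 hi) (Set.mem_Iic.2 (by omega : j ≤ n)) h
    omega
  rwa [hv, ← sub_smul, Submodule.smul_mem_iff _ (sub_ne_zero.2 hne)] at h1

/-- The eigenspace for `l i` is contained in `U (i + 1)` and meets `U i` trivially, so it embeds into the
quotient `U (i + 1) / U i`. -/
theorem finrank_eigenspace_le_of_triangular {d : ℕ → ℕ} (hU0 : U 0 = ⊥)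
    (hUmono : Monotone U) (hUtop : U (n + 1) = ⊤)
    (hA : ∀ i, ∀ v ∈ U (i + 1), A.mulVec v - l i • v ∈ U i)
    (hl : Set.InjOn l (Set.Iic n))
    (hd : ∀ i, Module.finrank ℝ (U (i + 1)) ≤ Module.finrank ℝ (U i) + d i)
    {i : ℕ} (hi : i ≤ n) :
    Module.finrank ℝ (Module.End.eigenspace A.mulVecLin (l i)) ≤ d i := by
  set E := Module.End.eigenspace A.mulVecLin (l i)
  have hE : ∀ v ∈ E, A.mulVec v = l i • v := fun v hv => by
    simpa using Module.End.mem_eigenspace_iff.1 hv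
  have h1 : E ≤ U (i + 1) := fun v hv =>
    mem_of_triangular hA hl hi (hE v hv) (hUtop ▸ Submodule.mem_top)
  have h2 : E ⊓ U i = ⊥ := by
    rw [eq_bot_iff]
    rintro v ⟨hv, hvi⟩
    by_contra h0
    obtain ⟨j, hj, e⟩ := exists_eq_of_triangular hU0 hA (hE v hv) (by simpa using h0) i hvi
    have := hl (Set.mem_Iic.2 hi) (Set.mem_Iic.2 (by omega : j ≤ n)) e
    omega
  have h3 := Submodule.finrank_sup_add_finrank_inf_eq E (U i)
  have h4 : Module.finrank ℝ ↥(E ⊔ U i) ≤ Module.finrank ℝ (U (i + 1)) :=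
    Submodule.finrank_mono (sup_le h1 (hUmono i.le_succ))
  rw [h2, finrank_bot] at h3
  have := hd i
  omega

/-- The trace of an even power of a symmetric matrix that acts on the quotients of a filtration as
distinct scalars `l i`, in terms of upper bounds `d i` for the dimensions of the quotients. The power
is even so that overestimating a multiplicity only increases the sum. -/
theorem trace_pow_le_of_triangular [DecidableEq V] {d : ℕ → ℕ} (hsymm : A.IsHermitian)
    (hU0 : U 0 = ⊥) (hUmono : Monotone U) (hUtop : U (n + 1) = ⊤)
    (hA : ∀ i, ∀ v ∈ U (i + 1), A.mulVec v - l i • v ∈ U i)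
    (hl : Set.InjOn l (Set.Iic n))
    (hd : ∀ i, Module.finrank ℝ (U (i + 1)) ≤ Module.finrank ℝ (U i) + d i) (t : ℕ) :
    (A ^ (2 * t)).trace ≤ ∑ i ∈ Finset.range (n + 1), (d i : ℝ) * l i ^ (2 * t) := by
  classical
  rw [hsymm.trace_pow_eq_sum_eigenvalues]
  have hlev : ∀ j, ∃ i < n + 1, hsymm.eigenvalues j = l i := fun j =>
    exists_eq_of_triangular hU0 hA (hsymm.mulVec_eigenvectorBasis j)
      (by simpa using hsymm.eigenvectorBasis.orthonormal.ne_zero j) (n + 1)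
      (hUtop ▸ Submodule.mem_top)
  choose r hr hrl using hlev
  rw [← Finset.sum_fiberwise_of_maps_to (t := Finset.range (n + 1)) (g := r)
    (fun j _ => Finset.mem_range.2 (hr j))]
  refine Finset.sum_le_sum fun i hi => ?_
  have hsum : ∑ j with r j = i, hsymm.eigenvalues j ^ (2 * t)
      = (Finset.univ.filter fun j => r j = i).card * l i ^ (2 * t) := by
    rw [← nsmul_eq_mul]
    refine Finset.sum_eq_card_nsmul fun j hj => ?_
    rw [hrl j, (Finset.mem_filter.1 hj).2]
  rw [hsum]
  refine mul_le_mul_of_nonneg_right (Nat.cast_le.2 ?_) ((even_two_mul t).pow_nonneg _)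
  refine le_trans ?_ (finrank_eigenspace_le_of_triangular hU0 hUmono hUtop hA hl hd
    (Nat.lt_succ_iff.1 (Finset.mem_range.1 hi)))
  have hli : LinearIndependent ℝ
      fun j : {j // r j = i} => (hsymm.eigenvectorBasis j).ofLp :=
    (hsymm.eigenvectorBasis.orthonormal.linearIndependent.map'
      (WithLp.linearEquiv 2 ℝ (V → ℝ)).toLinearMap (LinearEquiv.ker _)).comp
      (fun j : {j // r j = i} => (j : V)) Subtype.val_injective
  rw [← Fintype.card_subtype, ← finrank_span_eq_card hli]
  refine Submodule.finrank_mono (Submodule.span_le.2 ?_)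
  rintro _ ⟨j, rfl⟩
  rw [SetLike.mem_coe, Module.End.mem_eigenspace_iff, Matrix.mulVecLin_apply,
    hsymm.mulVec_eigenvectorBasis, hrl, j.2]

end Filtration

/-! ### Total variation from the trace -/

/-- The total variation distance is half the `ℓ¹` distance, which Cauchy–Schwarz bounds by the
`ℓ²` distance. -/
theorem tvDist_le {V : Type*} [Fintype V] {μ ν : V → ℝ} {b : ℝ} (hb : 0 ≤ b)
    (h1 : ∑ x, μ x = ∑ x, ν x)
    (h : (Fintype.card V : ℝ) * ∑ x, (μ x - ν x) ^ 2 ≤ 4 * b ^ 2) : tvDist μ ν ≤ b := by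
  classical
  refine ciSup_le fun S => ?_
  have hl1 : ∑ x, |μ x - ν x| ≤ 2 * b := by
    refine abs_le_of_sq_le_sq' ?_ (by positivity) |>.2
    calc (∑ x, |μ x - ν x|) ^ 2 ≤ (Fintype.card V : ℝ) * ∑ x, |μ x - ν x| ^ 2 :=
          sq_sum_le_card_mul_sum_sq
      _ ≤ (2 * b) ^ 2 := by simp only [sq_abs]; linarith
  have hc : ∑ x ∈ S, (μ x - ν x) + ∑ x ∈ Sᶜ, (μ x - ν x) = 0 := by
    rw [Finset.sum_add_sum_compl, Finset.sum_sub_distrib, h1, sub_self]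
  have ha : ∑ x ∈ S, |μ x - ν x| + ∑ x ∈ Sᶜ, |μ x - ν x| = ∑ x, |μ x - ν x| :=
    Finset.sum_add_sum_compl ..
  rw [← Finset.sum_sub_distrib]
  have h2 := Finset.abs_sum_le_sum_abs (fun x => μ x - ν x) S
  have h3 := Finset.abs_sum_le_sum_abs (fun x => μ x - ν x) Sᶜ
  rw [eq_neg_of_add_eq_zero_right hc, abs_neg] at h3
  linarith

open Classical in
/-- For a symmetric stochastic matrix whose `2t`-step return probabilities do not depend on the starting
point, `card V * ‖P ^ t (x, ·) - uniform‖₂² = tr P ^ (2t) - 1`. -/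
theorem worstTV_le_of_trace_le {V : Type*} [Fintype V] [Nonempty V] {P : Matrix V V ℝ}
    (hP : P.IsSymm) (hone : P.mulVec 1 = 1) {t : ℕ}
    (hdiag : ∀ x y, (P ^ (2 * t)) x x = (P ^ (2 * t)) y y) {b : ℝ} (hb : 0 ≤ b)
    (htr : (P ^ (2 * t)).trace - 1 ≤ 4 * b ^ 2) :
    worstTV P (fun _ => (Fintype.card V : ℝ)⁻¹) t ≤ b := by
  have hV : (Fintype.card V : ℝ) ≠ 0 := Nat.cast_ne_zero.2 Fintype.card_ne_zero
  refine ciSup_le fun x => ?_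
  have hrow : ∑ y, (P ^ t) x y = 1 := by
    have h : ∀ s : ℕ, (P ^ s).mulVec 1 = 1 := by
      intro s
      induction s with
      | zero => simp
      | succ s ih => rw [pow_succ, ← Matrix.mulVec_mulVec, hone, ih]
    simpa [Matrix.mulVec, dotProduct] using congrFun (h t) x
  have hsq : ∑ y, (P ^ t) x y ^ 2 = (P ^ (2 * t)) x x := by
    rw [two_mul, pow_add, Matrix.mul_apply]
    exact Finset.sum_congr rfl fun y _ => by rw [sq, (hP.pow t).apply y x]
  have htr' : (P ^ (2 * t)).trace = Fintype.card V * (P ^ (2 * t)) x x := by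
    calc (P ^ (2 * t)).trace = ∑ _y : V, (P ^ (2 * t)) x x :=
          Finset.sum_congr rfl fun y _ => hdiag y x
      _ = _ := by simp
  refine tvDist_le hb (by simp [hrow, hV]) ?_
  have hexp : ∑ y, ((P ^ t) x y - (Fintype.card V : ℝ)⁻¹) ^ 2
      = (P ^ (2 * t)) x x - (Fintype.card V : ℝ)⁻¹ := by
    simp only [sub_sq, Finset.sum_add_distrib, Finset.sum_sub_distrib, hsq, ← Finset.sum_mul,
      ← Finset.mul_sum, hrow]
    simp
    field_simp
    ring
  rw [hexp, mul_sub, ← htr', mul_inv_cancel₀ hV]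
  exact htr

/-! ### The transition matrix of the Kneser graph -/

/-- The number of vertices that contain `S` and are disjoint from `x`. For `S = ∅` it is the degree
of `x`. -/
theorem card_kneserVertex_superset_disjoint {n k : ℕ} (x : KneserVertex n k)
    (S : Finset (Fin (2 * n + k))) :
    (Finset.univ.filter fun y : KneserVertex n k => Disjoint x.1 y.1 ∧ S ⊆ y.1).card
      = if S.card ≤ n ∧ Disjoint S x.1 then (n + k - S.card).choose k else 0 := by
  split_ifs with h
  · obtain ⟨hS, hd⟩ := h
    have hmap : (Finset.univ.filter fun y : KneserVertex n k => Disjoint x.1 y.1 ∧ S ⊆ y.1).map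
        (Function.Embedding.subtype _) = (x.1ᶜ.powersetCard n).filter (S ⊆ ·) := by
      ext y
      simp [Finset.subset_compl_iff_disjoint_left, and_comm, and_assoc]
    rw [← Finset.card_map (Function.Embedding.subtype _), hmap,
      Finset.card_filter_powersetCard_subset S _ n (Finset.subset_compl_iff_disjoint_right.2 hd) hS,
      Finset.card_compl, x.2, Fintype.card_fin, show 2 * n + k - n = n + k by omega]
    exact Nat.choose_symm_of_eq_add (by omega)
  · refine Finset.card_eq_zero.2 (Finset.filter_eq_empty_iff.2 ?_)
    rintro y - ⟨h1, h2⟩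
    exact h ⟨(Finset.card_le_card h2).trans_eq y.2, (Finset.disjoint_of_subset_right h2 h1).symm⟩

theorem srwMatrix_kneserGraph_apply {n k : ℕ} (hn : 1 ≤ n) (x y : KneserVertex n k) :
    srwMatrix (kneserGraph n k) x y
      = if Disjoint x.1 y.1 then ((n + k).choose k : ℝ)⁻¹ else 0 := by
  classical
  have hadj : ∀ x y : KneserVertex n k, (kneserGraph n k).Adj x y ↔ Disjoint x.1 y.1 := by
    refine fun x y => ⟨fun h => h.2, fun h => ⟨?_, h⟩⟩
    rintro rfl
    have h0 := x.2
    rw [disjoint_self.1 h, Finset.bot_eq_empty, Finset.card_empty] at h0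
    omega
  have hdeg : (kneserGraph n k).degree x = (n + k).choose k := by
    have h := card_kneserVertex_superset_disjoint x ∅
    simp only [Finset.empty_subset, and_true, Finset.card_empty, Nat.zero_le,
      Finset.disjoint_empty_left, if_true, Nat.sub_zero] at h
    rw [← h, SimpleGraph.degree, SimpleGraph.neighborFinset_eq_filter]
    exact congrArg Finset.card (Finset.filter_congr fun y _ => hadj x y)
  rw [srwMatrix, Matrix.of_apply]
  simp only [hadj]
  split_ifs
  · rw [one_div, ← hdeg]
  · rfl

/-! ### The filtration by superset indicators -/

/-- The indicator function of the vertices that contain `S`. -/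
def supersetIndicator (n k : ℕ) (S : Finset (Fin (2 * n + k))) : KneserVertex n k → ℝ :=
  fun x => if S ⊆ x.1 then 1 else 0

/-- The span of the functions `supersetIndicator n k S` with `S` of fewer than `m` elements. The strict
inequality makes the filtration start at `⊥` and reach the whole space at `m = n + 1`. -/
def supersetSpan (n k m : ℕ) : Submodule ℝ (KneserVertex n k → ℝ) :=
  Submodule.span ℝ (supersetIndicator n k '' {S | S.card < m})

/-- The `i`-th eigenvalue of the simple random walk on `K(2n+k, n)`, for `i ≤ n`. The binomial
coefficients `C(n+k-i, n-i)` of the literature are written `C(n+k-i, k)`. -/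
noncomputable def kneserEigenvalue (n k i : ℕ) : ℝ :=
  (-1) ^ i * (n + k - i).choose k / (n + k).choose k

theorem supersetSpan_zero (n k : ℕ) : supersetSpan n k 0 = ⊥ := by
  simp [supersetSpan]

theorem supersetSpan_mono (n k : ℕ) : Monotone (supersetSpan n k) := fun _ _ h =>
  Submodule.span_mono (Set.image_mono fun _ hS => lt_of_lt_of_le hS h)

theorem supersetIndicator_mem {n k m : ℕ} {S : Finset (Fin (2 * n + k))} (hS : S.card < m) :
    supersetIndicator n k S ∈ supersetSpan n k m :=
  Submodule.subset_span ⟨S, hS, rfl⟩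

/-- For `S` of `n` elements, `supersetIndicator n k S` is the indicator of a single vertex. -/
theorem supersetSpan_succ_eq_top (n k : ℕ) : supersetSpan n k (n + 1) = ⊤ := by
  classical
  rw [eq_top_iff]
  intro v _
  have hv : v = ∑ x, v x • supersetIndicator n k x.1 := by
    funext y
    have : ∀ x : KneserVertex n k, x.1 ⊆ y.1 ↔ x = y := fun x =>
      ⟨fun h => Subtype.ext (Finset.eq_of_subset_of_card_le h (by rw [x.2, y.2])),
        fun h => h ▸ Finset.Subset.refl _⟩
    simp [supersetIndicator, Finset.sum_apply, this]
  rw [hv]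
  exact Submodule.sum_mem _ fun x _ =>
    Submodule.smul_mem _ _ (supersetIndicator_mem (by rw [x.2]; exact n.lt_succ_self))

theorem finrank_supersetSpan_succ_le (n k i : ℕ) :
    Module.finrank ℝ (supersetSpan n k (i + 1))
      ≤ Module.finrank ℝ (supersetSpan n k i) + (2 * n + k).choose i := by
  classical
  set F : Finset (KneserVertex n k → ℝ) :=
    (Finset.powersetCard i Finset.univ).image (supersetIndicator n k)
  have hF : supersetSpan n k (i + 1) = supersetSpan n k i ⊔ Submodule.span ℝ (F : Set _) := by
    rw [supersetSpan, supersetSpan, ← Submodule.span_union, Finset.coe_image, ← Set.image_union]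
    congr 2
    ext S
    simp [Nat.le_iff_lt_or_eq]
  have h1 : Module.finrank ℝ (Submodule.span ℝ (F : Set (KneserVertex n k → ℝ)))
      ≤ (2 * n + k).choose i := by
    refine (finrank_span_finset_le_card F).trans (Finset.card_image_le.trans ?_)
    rw [Finset.card_powersetCard, Finset.card_univ, Fintype.card_fin]
  rw [hF]
  exact (Submodule.finrank_add_le_finrank_add_finrank _ _).trans (Nat.add_le_add_left h1 _)

/-- Inclusion–exclusion for the event that a vertex is disjoint from `S`. -/
theorem sum_powerset_supersetIndicator {n k : ℕ} (S : Finset (Fin (2 * n + k)))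
    (x : KneserVertex n k) :
    ∑ T ∈ S.powerset, (-1 : ℝ) ^ T.card * supersetIndicator n k T x
      = if Disjoint S x.1 then 1 else 0 := by
  have h1 : ∑ T ∈ S.powerset, (-1 : ℝ) ^ T.card * supersetIndicator n k T x
      = ∑ T ∈ (S ∩ x.1).powerset, (-1 : ℝ) ^ T.card := by
    have : (S ∩ x.1).powerset = S.powerset.filter (· ⊆ x.1) := by
      ext T
      simp only [Finset.mem_powerset, Finset.mem_filter, Finset.subset_inter_iff]
    rw [this, Finset.sum_filter]
    simp [supersetIndicator]
  have h2 := congrArg (Int.cast : ℤ → ℝ)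
    (Finset.sum_powerset_neg_one_pow_card (x := S ∩ x.1))
  push_cast at h2
  rw [h1, h2]
  simp [Finset.disjoint_iff_inter_eq_empty]

theorem srwMatrix_mulVec_supersetIndicator {n k : ℕ} (hn : 1 ≤ n)
    {S : Finset (Fin (2 * n + k))} (hS : S.card ≤ n) :
    (srwMatrix (kneserGraph n k)).mulVec (supersetIndicator n k S)
      = ((n + k - S.card).choose k / (n + k).choose k : ℝ) •
        ∑ T ∈ S.powerset, (-1 : ℝ) ^ T.card • supersetIndicator n k T := by
  funext x
  have h := congrArg (Nat.cast : ℕ → ℝ) (card_kneserVertex_superset_disjoint x S)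
  rw [Finset.card_filter] at h
  simp only [hS, true_and] at h
  push_cast at h
  have hr := sum_powerset_supersetIndicator S x
  simp only [Pi.smul_apply, Finset.sum_apply, smul_eq_mul, hr, Matrix.mulVec, dotProduct,
    srwMatrix_kneserGraph_apply hn]
  calc _ = ((n + k).choose k : ℝ)⁻¹ *
        ∑ y : KneserVertex n k, (if Disjoint x.1 y.1 ∧ S ⊆ y.1 then (1 : ℝ) else 0) := by
        rw [Finset.mul_sum]
        refine Finset.sum_congr rfl fun y _ => ?_
        simp only [supersetIndicator, ite_and]
        split_ifs <;> simp
    _ = _ := by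
        rw [h]
        split_ifs
        · simp [div_eq_inv_mul]
        · simp

/-- The walk acts on the `i`-th quotient of the filtration as the scalar `kneserEigenvalue n k i`. -/
theorem srwMatrix_sub_smul_mem_supersetSpan {n k : ℕ} (hn : 1 ≤ n) (i : ℕ)
    (v : KneserVertex n k → ℝ) (hv : v ∈ supersetSpan n k (i + 1)) :
    (srwMatrix (kneserGraph n k)).mulVec v - kneserEigenvalue n k i • v
      ∈ supersetSpan n k i := by
  classical
  set P := srwMatrix (kneserGraph n k)
  suffices h : supersetSpan n k (i + 1) ≤
      (supersetSpan n k i).comap (P.mulVecLin - kneserEigenvalue n k i • LinearMap.id) by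
    simpa using h hv
  refine Submodule.span_le.2 ?_
  rintro _ ⟨S, hS, rfl⟩
  have hSi : S.card ≤ i := Nat.lt_succ_iff.1 hS
  simp only [SetLike.mem_coe, Submodule.mem_comap, LinearMap.sub_apply, Matrix.mulVecLin_apply,
    LinearMap.smul_apply, LinearMap.id_apply]
  -- No vertex contains a set of more than `n` elements, so the generator vanishes and the value of
  -- `kneserEigenvalue` beyond `n` is irrelevant.
  rcases lt_or_ge n S.card with hnS | hnS
  · have h0 : supersetIndicator n k S = 0 := by
      funext x
      have : ¬ S ⊆ x.1 := fun h => by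
        have := Finset.card_le_card h
        rw [x.2] at this
        omega
      simp [supersetIndicator, this]
    simp [h0]
  rw [srwMatrix_mulVec_supersetIndicator hn hnS]
  rcases hSi.lt_or_eq with hlt | rfl
  · refine Submodule.sub_mem _ (Submodule.smul_mem _ _ (Submodule.sum_mem _ fun T hT =>
      Submodule.smul_mem _ _ (supersetIndicator_mem ?_)))
      (Submodule.smul_mem _ _ (supersetIndicator_mem hlt))
    exact (Finset.card_le_card (Finset.mem_powerset.1 hT)).trans_lt hlt
  · have hsplit := Finset.sum_erase_add S.powerset
      (fun T => (-1 : ℝ) ^ T.card • supersetIndicator n k T) (Finset.mem_powerset_self S)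
    rw [← hsplit, smul_add, smul_smul, kneserEigenvalue, mul_comm _ ((-1 : ℝ) ^ S.card),
      ← mul_div_assoc, add_sub_cancel_right]
    refine Submodule.smul_mem _ _ (Submodule.sum_mem _ fun T hT =>
      Submodule.smul_mem _ _ (supersetIndicator_mem ?_))
    obtain ⟨hne, hT⟩ := Finset.mem_erase.1 hT
    exact Finset.card_lt_card (lt_of_le_of_ne (Finset.mem_powerset.1 hT) hne)

/-! ### Size and distinctness of the eigenvalues -/

theorem abs_kneserEigenvalue (n k i : ℕ) :
    |kneserEigenvalue n k i| = (n + k - i).choose k / (n + k).choose k := by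
  simp [kneserEigenvalue, abs_div, abs_mul]

theorem kneserEigenvalue_zero (n k : ℕ) : kneserEigenvalue n k 0 = 1 := by
  have : ((n + k).choose k : ℝ) ≠ 0 := Nat.cast_ne_zero.2 (Nat.choose_pos (by omega)).ne'
  simp [kneserEigenvalue, this]

theorem abs_kneserEigenvalue_succ {n k i : ℕ} (hi : i < n) :
    |kneserEigenvalue n k (i + 1)| = ((n - i : ℝ) / (n + k - i)) * |kneserEigenvalue n k i| := by
  obtain ⟨m, rfl⟩ := Nat.exists_eq_add_of_lt hi
  rw [abs_kneserEigenvalue, abs_kneserEigenvalue, show i + m + 1 + k - (i + 1) = m + k by omega,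
    show i + m + 1 + k - i = m + k + 1 by omega]
  have h := congrArg (Nat.cast : ℕ → ℝ) (Nat.choose_mul_succ_eq (m + k) k)
  rw [show m + k + 1 - k = m + 1 by omega] at h
  push_cast at h ⊢
  have h1 : ((i : ℝ) + m + 1 + k - i) ≠ 0 := by
    have : (0 : ℝ) < m + k + 1 := by positivity
    linarith
  rw [← mul_div_assoc]
  congr 1
  rw [div_mul_eq_mul_div, eq_div_iff h1]
  linear_combination h

theorem abs_kneserEigenvalue_le {n k i : ℕ} (hi : i ≤ n) :
    |kneserEigenvalue n k i| ≤ ((n : ℝ) / (n + k)) ^ i := by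
  induction i with
  | zero => simp [kneserEigenvalue_zero]
  | succ i ih =>
    have hin : (i : ℝ) < n := Nat.cast_lt.2 hi
    have hi0 : (0 : ℝ) ≤ i := i.cast_nonneg
    have hk0 : (0 : ℝ) ≤ k := k.cast_nonneg
    rw [abs_kneserEigenvalue_succ hi, pow_succ']
    refine mul_le_mul ?_ (ih (by omega)) (abs_nonneg _) (by positivity)
    rw [div_le_div_iff₀ (by linarith) (by linarith)]
    nlinarith

/-- The absolute values are strictly decreasing, which needs `1 ≤ k`. -/
theorem injOn_kneserEigenvalue {n k : ℕ} (hk : 1 ≤ k) :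
    Set.InjOn (kneserEigenvalue n k) (Set.Iic n) := by
  have hpos : (0 : ℝ) < (n + k).choose k := Nat.cast_pos.2 (Nat.choose_pos (by omega))
  have hlt : ∀ i < n, |kneserEigenvalue n k (i + 1)| < |kneserEigenvalue n k i| := by
    intro i hi
    have hin : (i : ℝ) < n := Nat.cast_lt.2 hi
    have hk1 : (1 : ℝ) ≤ k := Nat.one_le_cast.2 hk
    have hp : 0 < |kneserEigenvalue n k i| := by
      rw [abs_kneserEigenvalue]
      exact div_pos (Nat.cast_pos.2 (Nat.choose_pos (by omega))) hpos
    rw [abs_kneserEigenvalue_succ hi]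
    refine mul_lt_of_lt_one_left hp ?_
    rw [div_lt_one (by linarith)]
    linarith
  have hanti : StrictAntiOn (fun i => |kneserEigenvalue n k i|) (Set.Iic n) := by
    refine strictAntiOn_of_succ_lt Set.ordConnected_Iic fun i _ _ hi => ?_
    exact hlt i (Nat.lt_of_succ_le (Set.mem_Iic.1 hi))
  exact fun i hi j hj h => hanti.injOn hi hj (congrArg abs h)

/-! ### Stationarity, transitivity and the trace bound -/

theorem srwMatrix_kneserGraph_isSymm {n k : ℕ} (hn : 1 ≤ n) :
    (srwMatrix (kneserGraph n k)).IsSymm := by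
  ext x y
  simp only [Matrix.transpose_apply, srwMatrix_kneserGraph_apply hn, disjoint_comm]

theorem srwMatrix_kneserGraph_mulVec_one {n k : ℕ} (hn : 1 ≤ n) :
    (srwMatrix (kneserGraph n k)).mulVec 1 = 1 := by
  have h1 : (1 : KneserVertex n k → ℝ) = supersetIndicator n k ∅ := by
    funext x; simp [supersetIndicator]
  have hpos : ((n + k).choose k : ℝ) ≠ 0 := Nat.cast_ne_zero.2 (Nat.choose_pos (by omega)).ne'
  rw [h1, srwMatrix_mulVec_supersetIndicator hn (by simp)]
  simp [hpos]

instance kneserVertex_nonempty (n k : ℕ) : Nonempty (KneserVertex n k) := by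
  obtain ⟨A, -, hA⟩ := Finset.exists_subset_card_eq
    (s := (Finset.univ : Finset (Fin (2 * n + k)))) (n := n) (by simp; omega)
  exact ⟨⟨A, hA⟩⟩

/-- A stationary distribution is an eigenvector for the eigenvalue `1` of a symmetric matrix, hence lies
in the first step of the filtration, which consists of the constant functions. -/
theorem IsStationaryDist.eq_uniform {n k : ℕ} (hn : 1 ≤ n) (hk : 1 ≤ k)
    {π : KneserVertex n k → ℝ} (hπ : IsStationaryDist (srwMatrix (kneserGraph n k)) π) :
    π = fun _ => (Fintype.card (KneserVertex n k) : ℝ)⁻¹ := by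
  have hmul : (srwMatrix (kneserGraph n k)).mulVec π = kneserEigenvalue n k 0 • π := by
    rw [kneserEigenvalue_zero, one_smul, ← Matrix.vecMul_transpose,
      (srwMatrix_kneserGraph_isSymm hn).eq]
    exact hπ.stationary
  have hmem := mem_of_triangular (srwMatrix_sub_smul_mem_supersetSpan hn)
    (injOn_kneserEigenvalue hk) n.zero_le hmul
    (supersetSpan_succ_eq_top n k ▸ Submodule.mem_top)
  have hset : {S : Finset (Fin (2 * n + k)) | S.card < 0 + 1} = {∅} := by
    ext S; simp
  rw [supersetSpan, hset, Set.image_singleton, Submodule.mem_span_singleton] at hmem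
  obtain ⟨a, rfl⟩ := hmem
  have hsum := hπ.sum_eq_one
  funext x
  simp only [Pi.smul_apply, supersetIndicator, Finset.empty_subset, if_true, smul_eq_mul, mul_one,
    Finset.sum_const, Finset.card_univ, nsmul_eq_mul] at hsum ⊢
  exact eq_inv_of_mul_eq_one_right hsum

/-- Return probabilities are the same at all vertices, because permutations of the ground set act
transitively on the vertices and commute with the walk. -/
theorem srwMatrix_kneserGraph_pow_diag {n k : ℕ} [DecidableEq (KneserVertex n k)]
    (hn : 1 ≤ n) (m : ℕ) (x y : KneserVertex n k) :
    (srwMatrix (kneserGraph n k) ^ m) x x = (srwMatrix (kneserGraph n k) ^ m) y y := by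
  obtain ⟨σ, hσ⟩ : ∃ σ : Equiv.Perm (Fin (2 * n + k)), x.1.map σ.toEmbedding = y.1 := by
    have e : {a // a ∈ x.1} ≃ {a // a ∈ y.1} :=
      Fintype.equivOfCardEq (by simp [x.2, y.2])
    refine ⟨e.extendSubtype, Finset.eq_of_subset_of_card_le ?_ (by simp [x.2, y.2])⟩
    intro a ha
    obtain ⟨b, hb, rfl⟩ := Finset.mem_map.1 ha
    exact e.extendSubtype_mem b hb
  let τ : KneserVertex n k ≃ KneserVertex n k := σ.finsetCongr.subtypeEquiv fun A => by simp
  have hτ : ∀ z : KneserVertex n k, (τ z).1 = z.1.map σ.toEmbedding := fun _ => rfl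
  have hinv : Matrix.reindexAlgEquiv ℝ ℝ τ (srwMatrix (kneserGraph n k))
      = srwMatrix (kneserGraph n k) := by
    ext a b
    obtain ⟨a, rfl⟩ := τ.surjective a
    obtain ⟨b, rfl⟩ := τ.surjective b
    simp only [Matrix.coe_reindexAlgEquiv, Matrix.reindex_apply, Matrix.submatrix_apply,
      Equiv.symm_apply_apply, srwMatrix_kneserGraph_apply hn, hτ, Finset.disjoint_map]
  have hpow : Matrix.reindexAlgEquiv ℝ ℝ τ (srwMatrix (kneserGraph n k) ^ m)
      = srwMatrix (kneserGraph n k) ^ m := by rw [map_pow, hinv]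
  have hxy : τ x = y := Subtype.ext hσ
  have h := congrFun (congrFun hpow y) y
  rw [← h, ← hxy]
  simp only [Matrix.coe_reindexAlgEquiv, Matrix.reindex_apply, Matrix.submatrix_apply,
      Equiv.symm_apply_apply]

/-- The trace bound `∑ C(2n+k, i) λ_i ^ (2t)`, summed by the binomial theorem. -/
theorem trace_srwMatrix_kneserGraph_pow_le {n k : ℕ} [DecidableEq (KneserVertex n k)]
    (hn : 1 ≤ n) (hk : 1 ≤ k) (t : ℕ) :
    (srwMatrix (kneserGraph n k) ^ (2 * t)).trace
      ≤ Real.exp ((2 * n + k) * ((n : ℝ) / (n + k)) ^ (2 * t)) := by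
  set q : ℝ := ((n : ℝ) / (n + k)) ^ (2 * t) with hq
  have hq0 : 0 ≤ q := by positivity
  have hH : (srwMatrix (kneserGraph n k)).IsHermitian := by
    rw [Matrix.IsHermitian, Matrix.conjTranspose_eq_transpose_of_trivial]
    exact srwMatrix_kneserGraph_isSymm hn
  calc (srwMatrix (kneserGraph n k) ^ (2 * t)).trace
      ≤ ∑ i ∈ Finset.range (n + 1),
          ((2 * n + k).choose i : ℝ) * kneserEigenvalue n k i ^ (2 * t) :=
        trace_pow_le_of_triangular hH (supersetSpan_zero n k) (supersetSpan_mono n k)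
          (supersetSpan_succ_eq_top n k) (srwMatrix_sub_smul_mem_supersetSpan hn)
          (injOn_kneserEigenvalue hk) (finrank_supersetSpan_succ_le n k) t
    _ ≤ ∑ i ∈ Finset.range (n + 1), ((2 * n + k).choose i : ℝ) * q ^ i := by
        refine Finset.sum_le_sum fun i hi => mul_le_mul_of_nonneg_left ?_ (Nat.cast_nonneg _)
        rw [← (even_two_mul t).pow_abs, hq, pow_right_comm]
        exact pow_le_pow_left₀ (abs_nonneg _)
          (abs_kneserEigenvalue_le (Nat.lt_succ_iff.1 (Finset.mem_range.1 hi))) _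
    _ ≤ ∑ i ∈ Finset.range (2 * n + k + 1), ((2 * n + k).choose i : ℝ) * q ^ i :=
        Finset.sum_le_sum_of_subset_of_nonneg
          (Finset.range_subset_range.2 (by omega)) fun i _ _ => by positivity
    _ = (q + 1) ^ (2 * n + k) := by
        rw [add_pow]
        exact Finset.sum_congr rfl fun i _ => by rw [one_pow, mul_one, mul_comm]
    _ ≤ Real.exp q ^ (2 * n + k) :=
        pow_le_pow_left₀ (by positivity) (Real.add_one_le_exp q) _
    _ = Real.exp ((2 * n + k) * q) := by
        rw [← Real.exp_nat_mul]
        push_cast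
        rfl

theorem worstTV_kneserGraph_le {n k : ℕ} (hn : 1 ≤ n) (hk : 1 ≤ k)
    {π : KneserVertex n k → ℝ} (hπ : IsStationaryDist (srwMatrix (kneserGraph n k)) π)
    {t : ℕ} {b : ℝ} (hb : 0 ≤ b)
    (h : Real.exp ((2 * n + k) * ((n : ℝ) / (n + k)) ^ (2 * t)) - 1 ≤ 4 * b ^ 2) :
    worstTV (srwMatrix (kneserGraph n k)) π t ≤ b := by
  classical
  rw [hπ.eq_uniform hn hk]
  refine worstTV_le_of_trace_le (srwMatrix_kneserGraph_isSymm hn)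
    (srwMatrix_kneserGraph_mulVec_one hn) (fun x y => ?_) hb (le_trans ?_ h)
  · convert srwMatrix_kneserGraph_pow_diag hn (2 * t) x y
  · refine sub_le_sub_right (le_of_eq_of_le ?_ (trace_srwMatrix_kneserGraph_pow_le hn hk t)) 1
    -- The two sides differ only in the choice of a decidable equality on the vertices.
    congr!

/-! ### Mixing time estimates -/

theorem mul_pow_le_rpow {n k : ℕ} (hn : 1 ≤ n) (hk : 1 ≤ k) {t : ℕ} {s : ℝ}
    (ht : 1 / 2 * Real.logb (1 + (k : ℝ) / n) (2 * n + k) + s ≤ t) :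
    (2 * n + k) * ((n : ℝ) / (n + k)) ^ (2 * t) ≤ (1 + (k : ℝ) / n) ^ (-(2 * s)) := by
  have hn0 : (0 : ℝ) < n := Nat.cast_pos.2 hn
  have hk0 : (0 : ℝ) < k := Nat.cast_pos.2 hk
  set x : ℝ := 1 + (k : ℝ) / n with hx
  have hx1 : 1 < x := by rw [hx]; linarith [div_pos hk0 hn0]
  have hx0 : 0 < x := by linarith
  have hρ : (n : ℝ) / (n + k) = x⁻¹ := by rw [hx]; field_simp
  have hpow : ((n : ℝ) / (n + k)) ^ (2 * t) = x ^ (-(2 * t : ℝ)) := by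
    rw [hρ, Real.rpow_neg hx0.le, inv_pow, ← Real.rpow_natCast]
    push_cast
    rfl
  have hN : (2 * n + k : ℝ) = x ^ Real.logb x (2 * n + k) :=
    (Real.rpow_logb hx0 hx1.ne' (by positivity)).symm
  rw [hpow]
  nth_rewrite 1 [hN]
  rw [← Real.rpow_add hx0]
  exact Real.rpow_le_rpow_of_exponent_le hx1.le (by linarith)

theorem exp_sub_one_le_two_mul {a : ℝ} (h0 : 0 ≤ a) (h1 : a ≤ 1) : Real.exp a - 1 ≤ 2 * a := by
  have h := (abs_le.1 (Real.abs_exp_sub_one_sub_id_le (abs_le.2 ⟨by linarith, h1⟩))).2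
  nlinarith

/-- The quantity `(1+ε)^(-2s)` for `s = c / ε - 1`, where the `-1` is the loss from rounding the time
down: for small `ε` it is at most `e^{1/2}` times its limit `e^{-2c}`. -/
theorem rpow_le_exp_of_ratio_le {ε c : ℝ} (hε : 0 < ε) (hc : 1 / 2 ≤ c)
    (h : ε * (4 * (1 + c)) ≤ 1) :
    (1 + ε) ^ (-(2 * (c * ε⁻¹ - 1))) ≤ Real.exp (1 / 2 - 2 * c) := by
  have hx0 : 0 < 1 + ε := by linarith
  rw [Real.rpow_def_of_pos hx0, Real.exp_le_exp]
  have hεc : ε ≤ c := by nlinarith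
  have hlog : ε / (1 + ε) ≤ Real.log (1 + ε) := by
    have := Real.one_sub_inv_le_log_of_pos hx0
    rwa [show 1 - (1 + ε)⁻¹ = ε / (1 + ε) by field_simp; ring] at this
  have hs : 0 ≤ c * ε⁻¹ - 1 := by
    rw [← div_eq_mul_inv, sub_nonneg, one_le_div hε]
    exact hεc
  have h1 : ε / (1 + ε) * (c * ε⁻¹ - 1) ≤ Real.log (1 + ε) * (c * ε⁻¹ - 1) :=
    mul_le_mul_of_nonneg_right hlog hs
  have h2 : ε / (1 + ε) * (c * ε⁻¹ - 1) = (c - ε) / (1 + ε) := by field_simp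
  have h3 : c - 1 / 4 ≤ (c - ε) / (1 + ε) := by
    rw [le_div_iff₀ hx0]
    nlinarith
  linarith

theorem exp_half_le_two : Real.exp (1 / 2) ≤ 2 := by
  have h := exp_sub_one_le_two_mul (a := 1 / 2) (by norm_num) (by norm_num)
  linarith

theorem worstTV_kneserGraph_le_rpow {n k : ℕ} (hn : 1 ≤ n) (hk : 1 ≤ k)
    {π : KneserVertex n k → ℝ} (hπ : IsStationaryDist (srwMatrix (kneserGraph n k)) π)
    {c : ℝ} (hc : (1 + (k : ℝ) / n) ^ (-c) ≤ 1 / 2) {t : ℕ}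
    (ht : 1 / 2 * Real.logb (1 + (k : ℝ) / n) (2 * n + k) + c ≤ t) :
    worstTV (srwMatrix (kneserGraph n k)) π t ≤ (1 + (k : ℝ) / n) ^ (-c) := by
  have hx0 : (0 : ℝ) < 1 + (k : ℝ) / n := by positivity
  set b := (1 + (k : ℝ) / n) ^ (-c)
  have hb : 0 ≤ b := Real.rpow_nonneg hx0.le _
  refine worstTV_kneserGraph_le hn hk hπ hb ?_
  have ha := mul_pow_le_rpow hn hk ht
  have hsq : (1 + (k : ℝ) / n) ^ (-(2 * c)) = b ^ 2 := by
    rw [← Real.rpow_natCast, ← Real.rpow_mul hx0.le]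
    congr 1
    push_cast
    ring
  rw [hsq] at ha
  have h1 := exp_sub_one_le_two_mul (sq_nonneg b) (by nlinarith)
  linarith [Real.exp_le_exp.2 ha, sq_nonneg b]

theorem worstTVReal_kneserGraph_le_exp {n k : ℕ} (hn : 1 ≤ n) (hk : 1 ≤ k)
    {π : KneserVertex n k → ℝ} (hπ : IsStationaryDist (srwMatrix (kneserGraph n k)) π)
    {c : ℝ} (hc : 1 / 2 ≤ c) (hkn : (k : ℝ) / n * (4 * (1 + c)) ≤ 1) :
    worstTVReal (srwMatrix (kneserGraph n k)) π
        (1 / 2 * Real.logb (1 + (k : ℝ) / n) (2 * n + k) + c * (n / k)) ≤ Real.exp (-c) := by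
  have hn0 : (0 : ℝ) < n := Nat.cast_pos.2 hn
  have hk0 : (0 : ℝ) < k := Nat.cast_pos.2 hk
  refine worstTV_kneserGraph_le hn hk hπ (Real.exp_nonneg _) ?_
  set T := 1 / 2 * Real.logb (1 + (k : ℝ) / n) (2 * n + k) + c * (n / k) with hT
  have hfloor : 1 / 2 * Real.logb (1 + (k : ℝ) / n) (2 * n + k) + (c * ((k : ℝ) / n)⁻¹ - 1)
      ≤ (⌊T⌋₊ : ℝ) := by
    rw [inv_div]
    linarith [Nat.lt_floor_add_one T]
  have ha := (mul_pow_le_rpow hn hk hfloor).trans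
    (rpow_le_exp_of_ratio_le (div_pos hk0 hn0) hc hkn)
  have h1 := exp_sub_one_le_two_mul (Real.exp_nonneg (1 / 2 - 2 * c))
    (Real.exp_le_one_iff.2 (by linarith))
  have h2 : Real.exp (1 / 2 - 2 * c) = Real.exp (1 / 2) * Real.exp (-c) ^ 2 := by
    rw [← Real.exp_nat_mul, ← Real.exp_add]
    congr 1
    push_cast
    ring
  have h3 := mul_le_mul_of_nonneg_right exp_half_le_two (sq_nonneg (Real.exp (-c)))
  linarith [Real.exp_le_exp.2 ha]

theorem proposition1 (k : ℕ → ℕ) (hk : ∀ n, 1 ≤ n → 1 ≤ k n) :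
    ((fun n : ℕ => (k n : ℝ)) =o[atTop] (fun n : ℕ => (n : ℝ)) →
      ∀ c : ℝ, 1 / 2 ≤ c → ∀ᶠ n : ℕ in atTop,
        ∀ π : KneserVertex n (k n) → ℝ,
          IsStationaryDist (srwMatrix (kneserGraph n (k n))) π →
          worstTVReal (srwMatrix (kneserGraph n (k n))) π
              (1 / 2 * Real.logb (1 + (k n : ℝ) / n) (2 * n + k n) + c * (n / k n))
            ≤ Real.exp (-c)) ∧
    ((fun n : ℕ => (n : ℝ)) =O[atTop] (fun n : ℕ => (k n : ℝ)) →
      ∀ c : ℝ, ∀ n : ℕ, 1 ≤ n → (1 + (k n : ℝ) / n) ^ (-c) ≤ 1 / 2 →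
        ∀ π : KneserVertex n (k n) → ℝ,
          IsStationaryDist (srwMatrix (kneserGraph n (k n))) π →
          ∀ t : ℕ, 1 / 2 * Real.logb (1 + (k n : ℝ) / n) (2 * n + k n) + c ≤ t →
            worstTV (srwMatrix (kneserGraph n (k n))) π t
              ≤ (1 + (k n : ℝ) / n) ^ (-c)) := by
  refine ⟨fun ho c hc => ?_, fun _ c n hn hc π hπ t ht =>
    worstTV_kneserGraph_le_rpow hn (hk n hn) hπ hc ht⟩
  -- The ratio `k / n` has to be at most `1 / (4 * (1 + c))`, which holds eventually.
  have hc4 : (0 : ℝ) < 4 * (1 + c) := by linarith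
  filter_upwards [eventually_ge_atTop 1, ho.bound (inv_pos.2 hc4)] with n hn hb π hπ
  refine worstTVReal_kneserGraph_le_exp hn (hk n hn) hπ hc ?_
  rw [Real.norm_natCast, Real.norm_natCast, inv_mul_eq_div, le_div_iff₀ hc4] at hb
  rwa [div_mul_eq_mul_div, div_le_one (Nat.cast_pos.2 hn)]
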